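/- Consider a fixed-base serial chain of $N$ rigid bodies, numbered $1,\dots,N$ from the base (body $0$), in the absence of gravity. Joint $i$ has one degree of freedom, configuration $q_i\in\mathbb{R}$ and constant free-motion vector $\Phi_i\in\mathbb{R}^6$, and connects body $i-1$ to body $i$. The spatial velocities are $v_0=0$ and $v_i={}^iX_{J_i}(q_i)\,{}^{J_i}X_{i-1}\,v_{i-1}+\Phi_i\dot q_i$, where ${}^{J_i}X_{i-1}$ is a constant spatial transform (a rotation and a translation) and ${}^iX_{J_i}(q)=e^{-q(\Phi_i\times)}$, with $(\Phi_i\times)$ the $6\times6$ spatial cross product matrix. For $\pi\in\mathbb{R}^{10}$ (mass, first moments, moments and products of inertia) let $[\pi]^\wedge$ be the $6\times 6$ spatial inertia matrix with these parameters, and $[\cdot]^\vee$ the inverse map. The generalized force $\tau=H(q)\ddot q+c(q,\dot q)$ is linear in the parameters $\pi\in\mathbb{R}^{10N}$ of all bodies, $\tau=Y(q,\dot q,\ddot q)\,\pi$, and the structurally unidentifiable parameter subspace is $$\mathcal N=\{\pi\in\mathbb{R}^{10N} : Y(q,\dot q,\ddot q)\,\pi=0\ \text{ for all } q,\dot q,\ddot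 q\in\mathbb{R}^N\}.$$ Let $k(v)\in\mathbb{R}^{10}$ be the vector with $v^\top[\pi]^\wedge v=k(v)^\top\pi$ for all $\pi\in\mathbb{R}^{10}$. For $0\le i\le N$ let $V_i$ be any matrix whose range is $\mathrm{span}\{v_i(q,\dot q): q,\dot q\in\mathbb{R}^N\}$, and let $C_i$ be any matrix such that the range of $C_i^\top$ is $\mathrm{span}\{k(v_i(q,\dot q)): q,\dot q\in\mathbb{R}^N\}$. For a parameter change $\delta\pi=(\delta\pi_1,\dots,\delta\pi_N)\in\mathbb{R}^{10N}$ write $\delta I_j=[\delta\pi_j]^\wedge$, $\delta I_i^{(0)}=\delta I_i$ and $\delta I_i^{(k+1)}=(\Phi_i\times)^\top\delta I_i^{(k)}+\delta I_i^{(k)}(\Phi_i\times)$. For $i=1,\dots,N$ let $\mathcal T_i$ be the subspace of all $\delta\pi\in\mathbb{R}^{10N}$ for which there is a $\delta\pi_0\in\mathbb{R}^{10}$ (the change assigned to the base, which is not a parameter of the system and is arbitrary) such that - $\delta I_{i-1}=-\,({}^{J_i}X_{i-1})^\top\,\delta I_i\;{}^{J_i}X_{i-1}$ (transfer), - $V_i^\top\,\delta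 I_i\,\Phi_i=0$ (momentum), - $C_{i-1}\big[({}^{J_i}X_{i-1})^\top\,\delta I_i^{(k)}\;{}^{J_i}X_{i-1}\big]^\vee=0$ for $k=1,\dots,10$ (relaxed invariance), - $\delta I_j=0$ for all $j\in\{1,\dots,N\}\setminus\{i-1,i\}$. Then $$\mathcal N=\bigoplus_{i=1}^N\mathcal T_i .$$ -/

import Mathlib

open scoped Matrix

noncomputable section

namespace SerialChain

/-- Coordinates of a spatial (6D) vector: the angular block, then the linear block. -/
abbrev SpatialIdx : Type := Fin 3 ⊕ Fin 3

/-- Spatial vectors `(ω, v)`, i.e. elements of `ℝ⁶`. -/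
abbrev SpatialVec : Type := SpatialIdx → ℝ

/-- `6 × 6` real matrices. -/
abbrev SpatialMat : Type := Matrix SpatialIdx SpatialIdx ℝ

/-- The inertial parameters of one body, in the order
`m, h_x, h_y, h_z, I_xx, I_xy, I_xz, I_yy, I_yz, I_zz`. -/
abbrev Params : Type := Fin 10 → ℝ

/-- The 3D cross product matrix: `S(x) y = x × y`. -/
def skew (x : Fin 3 → ℝ) : Matrix (Fin 3) (Fin 3) ℝ :=
  !![0, -x 2, x 1; x 2, 0, -x 0; -x 1, x 0, 0]

theorem skew_mulVec (x y : Fin 3 → ℝ) : skew x *ᵥ y = crossProduct x y := by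
  ext i
  fin_cases i <;>
    simp [skew, cross_apply, Matrix.mulVec, dotProduct, Fin.sum_univ_three] <;> ring

/-- The spatial transform of a frame change with rotation matrix `R` (from the old frame to the
new one) and origin displacement `p` (in the old frame). -/
def spatialTransform (R : Matrix (Fin 3) (Fin 3) ℝ) (p : Fin 3 → ℝ) : SpatialMat :=
  Matrix.fromBlocks R 0 (-(R * skew p)) R

/-- The spatial cross product matrix `(φ ×)`. -/
def spatialCross (φ : SpatialVec) : SpatialMat :=
  Matrix.fromBlocks (skew fun k => φ (Sum.inl k)) 0
    (skew fun k => φ (Sum.inr k)) (skew fun k => φ (Sum.inl k))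

/-- `[π]^∧`: the spatial inertia matrix with inertial parameters `π`. -/
def wedge (π : Params) : SpatialMat :=
  Matrix.fromBlocks
    !![π 4, π 5, π 6; π 5, π 7, π 8; π 6, π 8, π 9]
    (skew ![π 1, π 2, π 3])
    (skew ![π 1, π 2, π 3])ᵀ
    (π 0 • (1 : Matrix (Fin 3) (Fin 3) ℝ))

/-- `[M]^∨`: the inertial parameters of a spatial inertia matrix `M`. -/
def vee (M : SpatialMat) : Params :=
  ![M (Sum.inr 0) (Sum.inr 0),
    M (Sum.inl 2) (Sum.inr 1), M (Sum.inl 0) (Sum.inr 2), M (Sum.inl 1) (Sum.inr 0),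
    M (Sum.inl 0) (Sum.inl 0), M (Sum.inl 0) (Sum.inl 1), M (Sum.inl 0) (Sum.inl 2),
    M (Sum.inl 1) (Sum.inl 1), M (Sum.inl 1) (Sum.inl 2), M (Sum.inl 2) (Sum.inl 2)]

theorem vee_wedge (π : Params) : vee (wedge π) = π := by
  ext k
  fin_cases k <;> simp [vee, wedge, skew]

theorem wedge_add (π ρ : Params) : wedge (π + ρ) = wedge π + wedge ρ := by
  ext (i | i) (j | j) <;> fin_cases i <;> fin_cases j <;> simp [wedge, skew] <;> ring

theorem wedge_smul (c : ℝ) (π : Params) : wedge (c • π) = c • wedge π := by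
  ext (i | i) (j | j) <;> fin_cases i <;> fin_cases j <;> simp [wedge, skew]

theorem wedge_zero : wedge 0 = 0 := by
  simpa using wedge_smul 0 0

theorem vee_add (M M' : SpatialMat) : vee (M + M') = vee M + vee M' := by
  ext k
  fin_cases k <;> simp [vee]

theorem vee_smul (c : ℝ) (M : SpatialMat) : vee (c • M) = c • vee M := by
  ext k
  fin_cases k <;> simp [vee]

/-- One derivative step `M ↦ (φ ×)ᵀ M + M (φ ×)`; the matrix `δI^(k)` is its `k`-th iterate
at `δI`. -/
def inertiaDeriv (φ : SpatialVec) (M : SpatialMat) : SpatialMat :=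
  (spatialCross φ)ᵀ * M + M * spatialCross φ

/-- The vector `k(v)` with `vᵀ [π]^∧ v = k(v)ᵀ π` for all `π`. -/
def energyVec (v : SpatialVec) : Params :=
  fun p => v ⬝ᵥ (wedge (Pi.single p 1) *ᵥ v)

theorem energyVec_dotProduct (v : SpatialVec) (π : Params) :
    energyVec v ⬝ᵥ π = v ⬝ᵥ (wedge π *ᵥ v) := by
  have h1 : (1 : Matrix (Fin 3) (Fin 3) ℝ) = !![1, 0, 0; 0, 1, 0; 0, 0, 1] := by
    ext i j
    fin_cases i <;> fin_cases j <;> simp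
  simp [energyVec, dotProduct, Matrix.mulVec, wedge, skew, h1, Fin.sum_univ_succ, Pi.single_apply]
  ring

/-- The transform `X(q)` across a 1-DoF joint with free motion `φ`: the solution of
`X(0) = 1`, `dX/dq = -(φ ×) X`. -/
def jointTransform (φ : SpatialVec) (q : ℝ) : SpatialMat :=
  NormedSpace.exp (-q • spatialCross φ)

theorem jointTransform_zero (φ : SpatialVec) : jointTransform φ 0 = 1 := by
  simp [jointTransform]

section
attribute [local instance] Matrix.linftyOpNormedRing Matrix.linftyOpNormedAlgebra

theorem hasDerivAt_jointTransform (φ : SpatialVec) (q : ℝ) (a b : SpatialIdx) :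
    HasDerivAt (fun t => jointTransform φ t a b)
      (-(spatialCross φ * jointTransform φ q) a b) q := by
  have h := hasDerivAt_exp_smul_const' (𝕂 := ℝ) (-spatialCross φ) q
  have h2 : HasDerivAt (jointTransform φ) (-(spatialCross φ * jointTransform φ q)) q := by
    have h3 : jointTransform φ = fun u : ℝ => NormedSpace.exp (u • -spatialCross φ) := by
      funext u
      simp [jointTransform]
    rw [h3]
    have h4 : -(spatialCross φ * (fun u : ℝ => NormedSpace.exp (u • -spatialCross φ)) q) =
        -spatialCross φ * NormedSpace.exp (q • -spatialCross φ) := by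
      rw [neg_mul]
    rw [h4]
    exact h
  exact hasDerivAt_pi.1 (hasDerivAt_pi.1 h2 a) b

end

end SerialChain

/-- A fixed-base serial chain of `N` bodies connected by 1-DoF joints. The bodies are numbered
`0, …, N`, where body `0` is the fixed base. The joint `i : Fin N` connects its predecessor, body
`i.castSucc`, to body `i.succ`. -/
structure SerialChain (N : ℕ) where
  /-- the free motion `Φ` of each joint, in the frame of the body after the joint -/
  freeMotion : Fin N → SerialChain.SpatialVec
  /-- the rotation part of the fixed transform from the predecessor's frame to the joint frame -/
  rot : Fin N → Matrix.specialOrthogonalGroup (Fin 3) ℝ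
  /-- the displacement of the joint frame from the predecessor's frame -/
  pos : Fin N → Fin 3 → ℝ

namespace SerialChain

variable {N : ℕ}

/-- The fixed transform `X` from the frame of the predecessor of joint `i` to its joint frame. -/
def fixedTransform (S : SerialChain N) (i : Fin N) : SpatialMat :=
  spatialTransform (S.rot i : Matrix (Fin 3) (Fin 3) ℝ) (S.pos i)

/-- The spatial velocity of each body at configuration `q` and joint rates `qd`. -/
def velocity (S : SerialChain N) (q qd : Fin N → ℝ) (b : Fin (N + 1)) : SpatialVec :=
  Fin.induction (motive := fun _ => SpatialVec) 0
    (fun i v => (jointTransform (S.freeMotion i) (q i) * S.fixedTransform i) *ᵥ v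
      + qd i • S.freeMotion i) b

theorem velocity_zero (S : SerialChain N) (q qd : Fin N → ℝ) : S.velocity q qd 0 = 0 := rfl

theorem velocity_succ (S : SerialChain N) (q qd : Fin N → ℝ) (i : Fin N) :
    S.velocity q qd i.succ =
      (jointTransform (S.freeMotion i) (q i) * S.fixedTransform i) *ᵥ S.velocity q qd i.castSucc
        + qd i • S.freeMotion i := rfl

/-- The kinetic energy of the chain with inertial parameters `π`. -/
def kineticEnergy (S : SerialChain N) (π : Fin N → Params) (q qd : Fin N → ℝ) : ℝ :=
  (1 / 2) * ∑ b : Fin N,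
    S.velocity q qd b.succ ⬝ᵥ (wedge (π b) *ᵥ S.velocity q qd b.succ)

/-- The mass matrix `H(q)`: the sum over the bodies of `Jᵀ I J`, where the columns of the body
Jacobian `J` are the velocities of the body under unit joint rates. -/
def massMatrix (S : SerialChain N) (π : Fin N → Params) (q : Fin N → ℝ) :
    Matrix (Fin N) (Fin N) ℝ :=
  Matrix.of fun j k => ∑ b : Fin N,
    S.velocity q (Pi.single j 1) b.succ ⬝ᵥ (wedge (π b) *ᵥ S.velocity q (Pi.single k 1) b.succ)

theorem velocity_eq_sum (S : SerialChain N) (q qd : Fin N → ℝ) (b : Fin (N + 1)) :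
    S.velocity q qd b = ∑ j, qd j • S.velocity q (Pi.single j 1) b := by
  induction b using Fin.induction with
  | zero => simp [velocity_zero]
  | succ i ih =>
    simp only [velocity_succ, smul_add, Finset.sum_add_distrib]
    rw [ih, Matrix.mulVec_sum]
    congr 1
    · simp only [Matrix.mulVec_smul]
    · simp [Pi.single_apply]

theorem kineticEnergy_eq (S : SerialChain N) (π : Fin N → Params) (q qd : Fin N → ℝ) :
    S.kineticEnergy π q qd = (1 / 2) * (qd ⬝ᵥ (S.massMatrix π q *ᵥ qd)) := by
  have h : ∀ b : Fin N, S.velocity q qd b.succ ⬝ᵥ (wedge (π b) *ᵥ S.velocity q qd b.succ) =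
      ∑ j, ∑ k, qd j * (S.velocity q (Pi.single j 1) b.succ ⬝ᵥ
        (wedge (π b) *ᵥ S.velocity q (Pi.single k 1) b.succ) * qd k) := by
    intro b
    rw [velocity_eq_sum, Matrix.mulVec_sum, sum_dotProduct]
    refine Finset.sum_congr rfl fun j _ => ?_
    rw [dotProduct_sum]
    refine Finset.sum_congr rfl fun k _ => ?_
    rw [Matrix.mulVec_smul, smul_dotProduct, dotProduct_smul, smul_eq_mul, smul_eq_mul]
    ring
  simp only [kineticEnergy, h]
  congr 1
  rw [Finset.sum_comm]
  refine Finset.sum_congr rfl fun j _ => ?_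
  rw [Finset.sum_comm]
  simp only [Matrix.mulVec, dotProduct, massMatrix, Matrix.of_apply, Finset.sum_mul,
    Finset.mul_sum]

/-- The partial derivative in `q_l` of the entry `j, k` of the mass matrix. -/
def massMatrixDeriv (S : SerialChain N) (π : Fin N → Params) (q : Fin N → ℝ) (l j k : Fin N) : ℝ :=
  fderiv ℝ (fun r => S.massMatrix π r j k) q (Pi.single l 1)

/-- The Coriolis and centrifugal force `c(q, qd)` of Lagrange's equations. -/
def coriolis (S : SerialChain N) (π : Fin N → Params) (q qd : Fin N → ℝ) : Fin N → ℝ :=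
  fun j => ∑ k, ∑ l,
    (S.massMatrixDeriv π q l j k - (1 / 2) * S.massMatrixDeriv π q j k l) * qd k * qd l

/-- The generalized force `τ = H(q) qdd + c(q, qd)` in the absence of gravity. -/
def torque (S : SerialChain N) (π : Fin N → Params) (q qd qdd : Fin N → ℝ) : Fin N → ℝ :=
  S.massMatrix π q *ᵥ qdd + S.coriolis π q qd

/-- The regressor `Y(q, qd, qdd)`: its column at parameter `p` of body `b` is the generalized
force that belongs to the corresponding unit parameter vector. -/
def regressor (S : SerialChain N) (q qd qdd : Fin N → ℝ) :
    Matrix (Fin N) (Fin N × Fin 10) ℝ :=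
  Matrix.of fun j bp => S.torque (Pi.single bp.1 (Pi.single bp.2 1)) q qd qdd j

theorem differentiable_velocity (S : SerialChain N) (qd : Fin N → ℝ) (b : Fin (N + 1))
    (a : SpatialIdx) : Differentiable ℝ fun q => S.velocity q qd b a := by
  induction b using Fin.induction generalizing a with
  | zero => simp [velocity_zero]
  | succ i ih =>
    have hJ : ∀ c d, Differentiable ℝ
        fun q : Fin N → ℝ => jointTransform (S.freeMotion i) (q i) c d := fun c d => by
      have h : Differentiable ℝ fun t => jointTransform (S.freeMotion i) t c d :=
        fun t => (hasDerivAt_jointTransform (S.freeMotion i) t c d).differentiableAt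
      exact h.comp (differentiable_apply i)
    simp only [velocity_succ, Matrix.mulVec, dotProduct, Matrix.mul_apply, Pi.add_apply,
      Pi.smul_apply]
    fun_prop

theorem differentiable_massMatrix (S : SerialChain N) (π : Fin N → Params) (j k : Fin N) :
    Differentiable ℝ fun q => S.massMatrix π q j k := by
  have h := fun qd b a => S.differentiable_velocity qd b a
  simp only [massMatrix, Matrix.of_apply, Matrix.mulVec, dotProduct]
  fun_prop

theorem massMatrix_add (S : SerialChain N) (π ρ : Fin N → Params) (q : Fin N → ℝ) :
    S.massMatrix (π + ρ) q = S.massMatrix π q + S.massMatrix ρ q := by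
  ext j k
  simp [massMatrix, wedge_add, Matrix.add_mulVec, Finset.sum_add_distrib]

theorem massMatrix_smul (S : SerialChain N) (c : ℝ) (π : Fin N → Params) (q : Fin N → ℝ) :
    S.massMatrix (c • π) q = c • S.massMatrix π q := by
  ext j k
  simp [massMatrix, wedge_smul, Matrix.smul_mulVec, Finset.mul_sum]

theorem massMatrixDeriv_add (S : SerialChain N) (π ρ : Fin N → Params) (q : Fin N → ℝ)
    (l j k : Fin N) : S.massMatrixDeriv (π + ρ) q l j k =
      S.massMatrixDeriv π q l j k + S.massMatrixDeriv ρ q l j k := by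
  simp only [massMatrixDeriv, massMatrix_add, Matrix.add_apply]
  rw [fderiv_fun_add (S.differentiable_massMatrix π j k q) (S.differentiable_massMatrix ρ j k q)]
  rfl

theorem massMatrixDeriv_smul (S : SerialChain N) (c : ℝ) (π : Fin N → Params) (q : Fin N → ℝ)
    (l j k : Fin N) : S.massMatrixDeriv (c • π) q l j k = c * S.massMatrixDeriv π q l j k := by
  simp only [massMatrixDeriv, massMatrix_smul, Matrix.smul_apply]
  rw [fderiv_fun_const_smul (S.differentiable_massMatrix π j k q)]
  rfl

/-- The generalized force as a linear function of the inertial parameters. -/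
def torqueLin (S : SerialChain N) (q qd qdd : Fin N → ℝ) :
    (Fin N → Params) →ₗ[ℝ] (Fin N → ℝ) where
  toFun π := S.torque π q qd qdd
  map_add' π ρ := by
    ext j
    simp only [torque, coriolis, massMatrix_add, massMatrixDeriv_add, Matrix.add_mulVec,
      Pi.add_apply]
    rw [add_add_add_comm, ← Finset.sum_add_distrib]
    congr 1
    refine Finset.sum_congr rfl fun k _ => ?_
    rw [← Finset.sum_add_distrib]
    refine Finset.sum_congr rfl fun l _ => ?_
    ring
  map_smul' c π := by
    ext j
    simp only [torque, coriolis, massMatrix_smul, massMatrixDeriv_smul, Matrix.smul_mulVec,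
      Pi.add_apply, Pi.smul_apply, smul_eq_mul, RingHom.id_apply, mul_add, Finset.mul_sum]
    congr 1
    refine Finset.sum_congr rfl fun k _ => Finset.sum_congr rfl fun l _ => ?_
    ring

theorem torque_eq_regressor_mulVec (S : SerialChain N) (π : Fin N → Params)
    (q qd qdd : Fin N → ℝ) :
    S.torque π q qd qdd =
      S.regressor q qd qdd *ᵥ (fun bp : Fin N × Fin 10 => π bp.1 bp.2) := by
  have hπ : π = ∑ bp : Fin N × Fin 10,
      π bp.1 bp.2 • (Pi.single bp.1 (Pi.single bp.2 1) : Fin N → Params) := by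
    ext b p
    simp [Fintype.sum_prod_type, Finset.sum_apply, Pi.single_apply, ite_apply]
  have h : S.torque π q qd qdd = S.torqueLin q qd qdd π := rfl
  rw [h]
  conv_lhs => rw [hπ]
  ext j
  simp [map_sum, Matrix.mulVec, dotProduct, regressor, torqueLin, mul_comm]

/-- The structurally unidentifiable parameters: all `π` with `Y(q, qd, qdd) π = 0` for all
`q, qd, qdd`. -/
def nullspace (S : SerialChain N) : Submodule ℝ (Fin N → Params) where
  carrier := {π | ∀ q qd qdd : Fin N → ℝ,
    S.regressor q qd qdd *ᵥ (fun bp : Fin N × Fin 10 => π bp.1 bp.2) = 0}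
  zero_mem' := fun q qd qdd => Matrix.mulVec_zero _
  add_mem' := by
    intro π ρ hπ hρ q qd qdd
    have h := congrArg₂ (· + ·) (hπ q qd qdd) (hρ q qd qdd)
    simp only [← Matrix.mulVec_add, add_zero] at h
    exact h
  smul_mem' := by
    intro c π hπ q qd qdd
    have h := congrArg (c • ·) (hπ q qd qdd)
    simp only [← Matrix.mulVec_smul, smul_zero] at h
    exact h

/-- The span of the attainable velocities of body `b`. -/
def velocitySpan (S : SerialChain N) (b : Fin (N + 1)) : Submodule ℝ SpatialVec :=
  Submodule.span ℝ {v | ∃ q qd : Fin N → ℝ, v = S.velocity q qd b}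

/-- The span of the vectors `k(v)` over the attainable velocities `v` of body `b`. -/
def energySpan (S : SerialChain N) (b : Fin (N + 1)) : Submodule ℝ Params :=
  Submodule.span ℝ {k | ∃ q qd : Fin N → ℝ, k = energyVec (S.velocity q qd b)}

/-- The conditions for `δ`, the parameter changes of all bodies including the base, to be an
undetectable transfer of inertia across joint `i`: transfer, momentum, relaxed invariance, and no
change of any other body. Here `V` describes the attainable velocities of the body after the joint
and `C` the identifiable parameters of its predecessor. -/
structure IsTransfer (S : SerialChain N) (i : Fin N) {m n : ℕ}
    (V : Matrix SpatialIdx (Fin m) ℝ) (C : Matrix (Fin n) (Fin 10) ℝ)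
    (δ : Fin (N + 1) → Params) : Prop where
  transfer : wedge (δ i.castSucc) =
    -((S.fixedTransform i)ᵀ * wedge (δ i.succ) * S.fixedTransform i)
  momentum : Vᵀ *ᵥ (wedge (δ i.succ) *ᵥ S.freeMotion i) = 0
  invariance : ∀ k ∈ Finset.Icc 1 10,
    C *ᵥ vee ((S.fixedTransform i)ᵀ * (inertiaDeriv (S.freeMotion i))^[k] (wedge (δ i.succ))
      * S.fixedTransform i) = 0
  others : ∀ j : Fin N, j.succ ≠ i.succ → j.succ ≠ i.castSucc → wedge (δ j.succ) = 0

theorem iterate_inertiaDeriv_add (φ : SpatialVec) (k : ℕ) (M M' : SpatialMat) :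
    (inertiaDeriv φ)^[k] (M + M') = (inertiaDeriv φ)^[k] M + (inertiaDeriv φ)^[k] M' := by
  induction k generalizing M M' with
  | zero => rfl
  | succ k ih =>
    simp only [Function.iterate_succ, Function.comp_apply]
    rw [← ih]
    congr 1
    simp only [inertiaDeriv, mul_add, add_mul]
    abel

theorem iterate_inertiaDeriv_smul (φ : SpatialVec) (k : ℕ) (c : ℝ) (M : SpatialMat) :
    (inertiaDeriv φ)^[k] (c • M) = c • (inertiaDeriv φ)^[k] M := by
  induction k generalizing M with
  | zero => rfl
  | succ k ih =>
    simp only [Function.iterate_succ, Function.comp_apply]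
    rw [← ih]
    congr 1
    simp [inertiaDeriv]

theorem IsTransfer.add {S : SerialChain N} {i : Fin N} {m n : ℕ}
    {V : Matrix SpatialIdx (Fin m) ℝ} {C : Matrix (Fin n) (Fin 10) ℝ}
    {δ ε : Fin (N + 1) → Params} (hδ : S.IsTransfer i V C δ) (hε : S.IsTransfer i V C ε) :
    S.IsTransfer i V C (δ + ε) where
  transfer := by
    simp only [Pi.add_apply, wedge_add, hδ.transfer, hε.transfer, mul_add, add_mul]
    abel
  momentum := by
    simp only [Pi.add_apply, wedge_add, Matrix.add_mulVec, Matrix.mulVec_add, hδ.momentum,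
      hε.momentum, add_zero]
  invariance := by
    intro k hk
    simp only [Pi.add_apply, wedge_add, iterate_inertiaDeriv_add, mul_add, add_mul, vee_add,
      Matrix.mulVec_add, hδ.invariance k hk, hε.invariance k hk, add_zero]
  others := by
    intro j h1 h2
    simp only [Pi.add_apply, wedge_add, hδ.others j h1 h2, hε.others j h1 h2, add_zero]

theorem IsTransfer.smul {S : SerialChain N} {i : Fin N} {m n : ℕ}
    {V : Matrix SpatialIdx (Fin m) ℝ} {C : Matrix (Fin n) (Fin 10) ℝ}
    {δ : Fin (N + 1) → Params} (c : ℝ) (hδ : S.IsTransfer i V C δ) :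
    S.IsTransfer i V C (c • δ) where
  transfer := by
    simp only [Pi.smul_apply, wedge_smul, hδ.transfer, Matrix.mul_smul, Matrix.smul_mul, smul_neg]
  momentum := by
    simp only [Pi.smul_apply, wedge_smul, Matrix.smul_mulVec, Matrix.mulVec_smul, hδ.momentum,
      smul_zero]
  invariance := by
    intro k hk
    simp only [Pi.smul_apply, wedge_smul, iterate_inertiaDeriv_smul, Matrix.mul_smul,
      Matrix.smul_mul, vee_smul, Matrix.mulVec_smul, hδ.invariance k hk, smul_zero]
  others := by
    intro j h1 h2
    simp only [Pi.smul_apply, wedge_smul, hδ.others j h1 h2, smul_zero]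

/-- The inertia transfer subspace of joint `i`. The parameter change `δ₀` of the base is not part
of the system's parameters and may be arbitrary. -/
def transferSubspace (S : SerialChain N) (i : Fin N) {m n : ℕ}
    (V : Matrix SpatialIdx (Fin m) ℝ) (C : Matrix (Fin n) (Fin 10) ℝ) :
    Submodule ℝ (Fin N → Params) where
  carrier := {δ | ∃ δ₀ : Params, S.IsTransfer i V C (Fin.cons δ₀ δ)}
  zero_mem' := by
    refine ⟨0, ?_⟩
    have h0 : (Fin.cons 0 0 : Fin (N + 1) → Params) = 0 := by
      funext b
      refine Fin.cases ?_ (fun j => ?_) b <;> simp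
    rw [h0]
    have hz : ∀ k, (inertiaDeriv (S.freeMotion i))^[k] 0 = 0 := fun k => by
      simpa using iterate_inertiaDeriv_smul (S.freeMotion i) k 0 0
    have hv : vee 0 = 0 := by simpa using vee_smul 0 0
    exact ⟨by simp [wedge_zero], by simp [wedge_zero], by simp [wedge_zero, hz, hv],
      by simp [wedge_zero]⟩
  add_mem' := by
    rintro δ ε ⟨δ₀, hδ⟩ ⟨ε₀, hε⟩
    refine ⟨δ₀ + ε₀, ?_⟩
    have h : (Fin.cons (δ₀ + ε₀) (δ + ε) : Fin (N + 1) → Params)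
        = Fin.cons δ₀ δ + Fin.cons ε₀ ε := by
      funext b
      refine Fin.cases ?_ (fun j => ?_) b <;> simp
    rw [h]
    exact hδ.add hε
  smul_mem' := by
    rintro c δ ⟨δ₀, hδ⟩
    refine ⟨c • δ₀, ?_⟩
    have h : (Fin.cons (c • δ₀) (c • δ) : Fin (N + 1) → Params) = c • Fin.cons δ₀ δ := by
      funext b
      refine Fin.cases ?_ (fun j => ?_) b <;> simp
    rw [h]
    exact hδ.smul c

end SerialChain

end

/-!
A parameter change is unidentifiable if and only if it carries no kinetic energy: at rest the
generalized force is `H(q) q̈`, so the mass matrix vanishes, and then so does the Coriolis force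
(`SerialChain.mem_nullspace_iff`).

The energy of the body after joint `i` is a function of the joint position `t`, the joint rate `s`
and the velocity of the predecessor. The momentum condition says that it does not depend on `s`,
the invariance condition that it does not depend on `t`. For the latter, the inertia seen from
before the joint solves `F' = -L F` in `t`, where `L` is `inertiaDeriv`, so it is constant on a
given velocity if and only if all `Lᵏ` with `k ≥ 1` of the inertia vanish there. As `L` and the
change of frame preserve the ten-dimensional space of spatial inertia matrices, `k ≤ 10` suffices
by the Cayley-Hamilton theorem (`SerialChain.invariance_iff`).

Hence in a transfer the energies of the two bodies cancel, and every transfer is unidentifiable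
(`SerialChain.transferSubspace_le_nullspace`). Conversely, let `i` be the last body changed by an
unidentifiable change. No other changed body sees the motion of joint `i`, so the energy of body `i`
is independent of `t` and `s`, and its parameters can be transferred to the predecessor
(`SerialChain.transferChange_mem_transferSubspace`). Subtracting this transfer leaves an
unidentifiable change of the bodies before `i`, and induction gives a sum of transfers. The sum is
direct because a transfer across joint `i` does not touch the bodies after `i` and vanishes if it
does not change body `i` (`SerialChain.iSupIndep_transferSubspace`).
-/

noncomputable section

namespace SerialChain

/-! ### Spatial inertia matrices -/

theorem transpose_skew (x : Fin 3 → ℝ) : (skew x)ᵀ = -skew x := by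
  ext i j
  fin_cases i <;> fin_cases j <;> simp [skew]

theorem transpose_wedge (π : Params) : (wedge π)ᵀ = wedge π := by
  have h : (!![π 4, π 5, π 6; π 5, π 7, π 8; π 6, π 8, π 9] : Matrix (Fin 3) (Fin 3) ℝ)ᵀ =
      !![π 4, π 5, π 6; π 5, π 7, π 8; π 6, π 8, π 9] := by
    ext i j
    fin_cases i <;> fin_cases j <;> rfl
  rw [wedge, Matrix.fromBlocks_transpose, h]
  simp

theorem dotProduct_wedge_mulVec_comm (π : Params) (x y : SpatialVec) :
    x ⬝ᵥ (wedge π *ᵥ y) = y ⬝ᵥ (wedge π *ᵥ x) := by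
  rw [Matrix.dotProduct_mulVec, ← Matrix.mulVec_transpose, transpose_wedge, dotProduct_comm]

theorem exists_skew_eq {B : Matrix (Fin 3) (Fin 3) ℝ} (hB : Bᵀ = -B) : ∃ h, B = skew h := by
  have h (i j) : B j i = -B i j := congrFun (congrFun hB i) j
  refine ⟨![B 2 1, B 0 2, B 1 0], ?_⟩
  ext i j
  fin_cases i <;> fin_cases j <;> simp [skew] <;> linarith [h 0 0, h 1 1, h 2 2, h 0 1, h 0 2, h 1 2]

/-- The spatial inertia matrices are the block matrices with symmetric rotational part, skew
coupling and scalar mass block; for these `vee` is inverse to `wedge`. -/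
theorem wedge_vee_fromBlocks {J B : Matrix (Fin 3) (Fin 3) ℝ} (m : ℝ)
    (hJ : Jᵀ = J) (hB : Bᵀ = -B) :
    wedge (vee (Matrix.fromBlocks J B Bᵀ (m • 1))) = Matrix.fromBlocks J B Bᵀ (m • 1) := by
  obtain ⟨h, rfl⟩ := exists_skew_eq hB
  have hJ' (i j) : J j i = J i j := congrFun (congrFun hJ i) j
  ext (i | i) (j | j) <;> fin_cases i <;> fin_cases j <;>
    simp [wedge, vee, skew, hJ' 0 1, hJ' 0 2, hJ' 1 2]

/-- The derivative step `(φ ×)ᵀ M + M (φ ×)` maps spatial inertia matrices to spatial inertia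
matrices. -/
theorem wedge_vee_inertiaDeriv (φ : SpatialVec) (π : Params) :
    wedge (vee (inertiaDeriv φ (wedge π))) = inertiaDeriv φ (wedge π) := by
  set w := skew fun k => φ (Sum.inl k) with hw
  set v := skew fun k => φ (Sum.inr k) with hv
  have hwt : wᵀ = -w := transpose_skew _
  have hvt : vᵀ = -v := transpose_skew _
  have hI := transpose_wedge π
  set J : Matrix (Fin 3) (Fin 3) ℝ := !![π 4, π 5, π 6; π 5, π 7, π 8; π 6, π 8, π 9] with hJ
  set H := skew ![π 1, π 2, π 3] with hH
  have hHt : Hᵀ = -H := transpose_skew _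
  have hM : wedge π = Matrix.fromBlocks J H Hᵀ (π 0 • 1) := rfl
  have hJt : Jᵀ = J := by
    rw [hM, Matrix.fromBlocks_transpose] at hI
    exact (Matrix.fromBlocks_inj.1 hI).1
  have key : inertiaDeriv φ (wedge π) = Matrix.fromBlocks
      (-(w * J) + v * H + (J * w + H * v))
      (-(w * H) - π 0 • v + H * w)
      (-(w * H) - π 0 • v + H * w)ᵀ ((0 : ℝ) • 1) := by
    rw [inertiaDeriv, hM, spatialCross, ← hw, ← hv, Matrix.fromBlocks_transpose,
      Matrix.fromBlocks_multiply, Matrix.fromBlocks_multiply, Matrix.fromBlocks_add]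
    simp only [hwt, hvt, hHt, Matrix.transpose_zero]
    congr 1
    · noncomm_ring
    · simp
      noncomm_ring
    · simp [Matrix.transpose_mul, hwt, hvt, hHt]
      abel
    · simp
  rw [key]
  refine wedge_vee_fromBlocks 0 ?_ ?_
  · simp [Matrix.transpose_mul, hwt, hvt, hHt, hJt]
    abel
  · simp [Matrix.transpose_mul, hwt, hvt, hHt]
    abel

/-- A change of frame maps spatial inertia matrices to spatial inertia matrices. -/
theorem wedge_vee_spatialTransform {R : Matrix (Fin 3) (Fin 3) ℝ} (hR : Rᵀ * R = 1)
    (p : Fin 3 → ℝ) (π : Params) :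
    wedge (vee ((spatialTransform R p)ᵀ * wedge π * spatialTransform R p)) =
      (spatialTransform R p)ᵀ * wedge π * spatialTransform R p := by
  set s := skew p with hs
  have hst : sᵀ = -s := transpose_skew _
  have hI := transpose_wedge π
  set J : Matrix (Fin 3) (Fin 3) ℝ := !![π 4, π 5, π 6; π 5, π 7, π 8; π 6, π 8, π 9] with hJ
  set H := skew ![π 1, π 2, π 3] with hH
  have hHt : Hᵀ = -H := transpose_skew _
  have hM : wedge π = Matrix.fromBlocks J H Hᵀ (π 0 • 1) := rfl
  have hJt : Jᵀ = J := by
    rw [hM, Matrix.fromBlocks_transpose] at hI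
    exact (Matrix.fromBlocks_inj.1 hI).1
  have key : (spatialTransform R p)ᵀ * wedge π * spatialTransform R p = Matrix.fromBlocks
      (Rᵀ * J * R - s * Rᵀ * H * R - Rᵀ * H * R * s - π 0 • (s * s))
      (Rᵀ * H * R + π 0 • s)
      (Rᵀ * H * R + π 0 • s)ᵀ (π 0 • 1) := by
    have hR' (A : Matrix (Fin 3) (Fin 3) ℝ) : Rᵀ * (R * A) = A := by
      rw [← Matrix.mul_assoc, hR, Matrix.one_mul]
    rw [hM, spatialTransform, ← hs, Matrix.fromBlocks_transpose,
      Matrix.fromBlocks_multiply, Matrix.fromBlocks_multiply]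
    simp only [hst, hHt, Matrix.transpose_zero, Matrix.transpose_neg, Matrix.transpose_mul]
    congr 1
    · simp [Matrix.mul_assoc, hR', Matrix.add_mul]
      abel
    · simp [Matrix.mul_assoc, hR, Matrix.add_mul]
    · simp [Matrix.mul_assoc, hR', hHt, hst]
    · simp [hR]
  rw [key]
  refine wedge_vee_fromBlocks _ ?_ ?_
  · simp [Matrix.transpose_mul, hst, hHt, hJt, Matrix.mul_assoc]
    abel
  · simp [Matrix.transpose_mul, hst, hHt, Matrix.mul_assoc]
    abel

theorem wedge_vee_fixedTransform {N : ℕ} (S : SerialChain N) (i : Fin N) (π : Params) :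
    wedge (vee ((S.fixedTransform i)ᵀ * wedge π * S.fixedTransform i)) =
      (S.fixedTransform i)ᵀ * wedge π * S.fixedTransform i :=
  wedge_vee_spatialTransform
    ((Matrix.mem_orthogonalGroup_iff' _ _).1
      (Matrix.mem_specialOrthogonalGroup_iff.1 (S.rot i).2).1) _ π

/-! ### Transport of an inertia matrix across a joint -/

/-- `inertiaDeriv φ` in the coordinates `Params`. -/
def paramsDeriv (φ : SpatialVec) : Module.End ℝ Params where
  toFun π := vee (inertiaDeriv φ (wedge π))
  map_add' π ρ := by
    rw [wedge_add, ← vee_add]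
    exact congrArg vee (iterate_inertiaDeriv_add φ 1 _ _)
  map_smul' c π := by
    rw [wedge_smul, RingHom.id_apply, ← vee_smul]
    exact congrArg vee (iterate_inertiaDeriv_smul φ 1 _ _)

theorem wedge_paramsDeriv_pow (φ : SpatialVec) (k : ℕ) (π : Params) :
    wedge ((paramsDeriv φ ^ k) π) = (inertiaDeriv φ)^[k] (wedge π) := by
  induction k with
  | zero => rfl
  | succ k ih =>
    rw [pow_succ', Module.End.mul_apply, Function.iterate_succ_apply', ← ih]
    exact wedge_vee_inertiaDeriv φ _

/-- By the Cayley-Hamilton theorem, a functional that vanishes on the first `finrank` many proper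
iterates of a vector under an endomorphism vanishes on all of them. -/
theorem apply_pow_eq_zero_of_le_finrank {W : Type*} [AddCommGroup W] [Module ℝ W]
    [FiniteDimensional ℝ W] [Nontrivial W] (A : Module.End ℝ W) (f : W →ₗ[ℝ] ℝ) (w : W)
    (h : ∀ k ∈ Finset.Icc 1 (Module.finrank ℝ W), f ((A ^ k) w) = 0) {k : ℕ} (hk : 1 ≤ k) :
    f ((A ^ k) w) = 0 := by
  obtain ⟨k, rfl⟩ := Nat.exists_eq_add_of_le' hk
  have hdeg : (Polynomial.X ^ k %ₘ A.charpoly).natDegree < Module.finrank ℝ W := by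
    rw [← LinearMap.charpoly_natDegree A]
    refine Polynomial.natDegree_modByMonic_lt _ (LinearMap.charpoly_monic A) fun h1 => ?_
    have h2 := LinearMap.charpoly_natDegree A
    rw [h1, Polynomial.natDegree_one] at h2
    exact (Module.finrank_pos (R := ℝ) (M := W)).ne h2
  rw [pow_succ, LinearMap.pow_eq_aeval_mod_charpoly, Polynomial.aeval_eq_sum_range' hdeg,
    Finset.sum_mul, LinearMap.sum_apply, map_sum]
  refine Finset.sum_eq_zero fun j hj => ?_
  rw [smul_mul_assoc, ← pow_succ, LinearMap.smul_apply, map_smul,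
    h (j + 1) (by have := Finset.mem_range.1 hj; simp; omega), smul_zero]

/-- Along a solution of `F' = -L F`, a functional that vanishes on all proper iterates of the
initial value under `L` is constant: expand `F t = exp (-t L) (F 0)`. -/
theorem apply_eq_of_hasDerivAt_neg {E : Type*} [NormedAddCommGroup E] [NormedSpace ℝ E]
    [FiniteDimensional ℝ E] (L : Module.End ℝ E) (F : ℝ → E)
    (hF : ∀ t, HasDerivAt F (-L (F t)) t) (f : E →ₗ[ℝ] ℝ)
    (h : ∀ k, 1 ≤ k → f ((L ^ k) (F 0)) = 0) (t : ℝ) : f (F t) = f (F 0) := by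
  have : CompleteSpace E := FiniteDimensional.complete ℝ E
  set A : E →L[ℝ] E := LinearMap.toContinuousLinearMap (-L) with hA
  have hexp : F = fun t => NormedSpace.exp (t • A) (F 0) := by
    refine ODE_solution_unique_univ (t₀ := 0) (v := fun _ => A)
      (s := fun _ => Set.univ) (fun _ => A.lipschitz.lipschitzOnWith)
      (fun t => ⟨hF t, trivial⟩) (fun t => ⟨?_, trivial⟩) ?_
    · exact ((ContinuousLinearMap.apply ℝ E (F 0)).hasFDerivAt.comp_hasDerivAt t
        (hasDerivAt_exp_smul_const' (𝕂 := ℝ) A t))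
    · simp
  have hpow (k : ℕ) (y : E) : (A ^ k) y = ((-1 : ℝ) ^ k) • (L ^ k) y := by
    induction k with
    | zero => simp
    | succ k ih =>
      rw [pow_succ', mul_apply_eq_comp, ih, map_smul, pow_succ', pow_succ' L]
      simp [hA]
  have hs := ((NormedSpace.exp_series_hasSum_exp' (𝕂 := ℝ) (t • A)).mapL
    (ContinuousLinearMap.apply ℝ E (F 0))).mapL (LinearMap.toContinuousLinearMap f)
  refine (congrArg f (congrFun hexp t)).trans ((hs.unique (hasSum_single 0 fun k hk => ?_)).trans ?_)
  · simp [smul_pow, hpow, h k (by omega)]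
  · simp

section
attribute [local instance] Matrix.linftyOpNormedRing Matrix.linftyOpNormedAlgebra

theorem hasDerivAt_transport (φ : SpatialVec) (M : SpatialMat) (t : ℝ) :
    HasDerivAt (fun t => (jointTransform φ t)ᵀ * M * jointTransform φ t)
      (-((jointTransform φ t)ᵀ * inertiaDeriv φ M * jointTransform φ t)) t := by
  have h1 : HasDerivAt (jointTransform φ) (-(spatialCross φ * jointTransform φ t)) t :=
    hasDerivAt_pi.2 fun a => hasDerivAt_pi.2 fun b => hasDerivAt_jointTransform φ t a b
  have h2 : HasDerivAt (fun t => (jointTransform φ t)ᵀ)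
      (-(spatialCross φ * jointTransform φ t))ᵀ t :=
    hasDerivAt_pi.2 fun a => hasDerivAt_pi.2 fun b => hasDerivAt_jointTransform φ t b a
  refine ((h2.mul_const M).mul h1).congr_deriv ?_
  simp only [inertiaDeriv, Matrix.transpose_neg, Matrix.transpose_mul]
  noncomm_ring

theorem transport_inertiaDeriv (φ : SpatialVec) (M : SpatialMat) (t : ℝ) :
    (jointTransform φ t)ᵀ * inertiaDeriv φ M * jointTransform φ t =
      inertiaDeriv φ ((jointTransform φ t)ᵀ * M * jointTransform φ t) := by
  have h : Commute (spatialCross φ) (jointTransform φ t) :=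
    ((Commute.refl _).smul_right (-t)).exp_right
  have ht := congrArg Matrix.transpose h.eq
  simp only [Matrix.transpose_mul] at ht
  simp only [inertiaDeriv, mul_add, add_mul, ← mul_assoc, ht]
  simp only [mul_assoc, h.eq]

/-- The quadratic form `M ↦ xᵀ M x` as a continuous linear functional of the matrix. -/
def quadraticEval (x : SpatialVec) : SpatialMat →L[ℝ] ℝ :=
  LinearMap.toContinuousLinearMap
    { toFun := fun M => x ⬝ᵥ (M *ᵥ x)
      map_add' := fun M M' => by rw [Matrix.add_mulVec, dotProduct_add]
      map_smul' := fun c M => by rw [Matrix.smul_mulVec, dotProduct_smul]; rfl }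

/-- If the energy of a body as seen from the other side of a joint does not depend on the joint
position, all derivative matrices of its inertia are invisible. -/
theorem iterate_inertiaDeriv_eq_zero_of_transport_const (φ : SpatialVec) (M : SpatialMat)
    (x : SpatialVec)
    (h : ∀ t, x ⬝ᵥ (((jointTransform φ t)ᵀ * M * jointTransform φ t) *ᵥ x) = x ⬝ᵥ (M *ᵥ x))
    {k : ℕ} (hk : 1 ≤ k) : x ⬝ᵥ ((inertiaDeriv φ)^[k] M *ᵥ x) = 0 := by
  have hd (M : SpatialMat) (t : ℝ) := (quadraticEval x).hasFDerivAt.comp_hasDerivAt t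
    (hasDerivAt_transport φ M t)
  have step (M : SpatialMat) (c : ℝ)
      (hM : ∀ t, quadraticEval x ((jointTransform φ t)ᵀ * M * jointTransform φ t) = c) (t : ℝ) :
      quadraticEval x ((jointTransform φ t)ᵀ * inertiaDeriv φ M * jointTransform φ t) = 0 := by
    have h1 := hd M t
    have h2 : (quadraticEval x ∘ fun t => (jointTransform φ t)ᵀ * M * jointTransform φ t) =
      fun _ => c := funext hM
    rw [h2] at h1
    have h3 := h1.unique (hasDerivAt_const t c)
    exact neg_eq_zero.1 ((map_neg (quadraticEval x) _).symm.trans h3)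
  have all (k : ℕ) (t : ℝ) : quadraticEval x
      ((jointTransform φ t)ᵀ * (inertiaDeriv φ)^[k + 1] M * jointTransform φ t) = 0 := by
    induction k generalizing t with
    | zero => exact step M _ h t
    | succ k ih =>
      rw [Function.iterate_succ_apply']
      exact step _ 0 ih t
  obtain ⟨k, rfl⟩ := Nat.exists_eq_add_of_le' hk
  simpa [jointTransform_zero, quadraticEval] using all k 0

/-- If all derivative matrices of an inertia are invisible, then the energy of the body as seen
from the other side of the joint does not depend on the joint position: expand in `t`. -/
theorem transport_const_of_iterate_inertiaDeriv_eq_zero (φ : SpatialVec) (M : SpatialMat)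
    (x : SpatialVec) (h : ∀ k, 1 ≤ k → x ⬝ᵥ ((inertiaDeriv φ)^[k] M *ᵥ x) = 0) (t : ℝ) :
    x ⬝ᵥ (((jointTransform φ t)ᵀ * M * jointTransform φ t) *ᵥ x) = x ⬝ᵥ (M *ᵥ x) := by
  let L : Module.End ℝ SpatialMat :=
    { toFun := inertiaDeriv φ
      map_add' := iterate_inertiaDeriv_add φ 1
      map_smul' := iterate_inertiaDeriv_smul φ 1 }
  have hL (k : ℕ) (M : SpatialMat) : (L ^ k) M = (inertiaDeriv φ)^[k] M :=
    Module.End.pow_apply L k M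
  have key := apply_eq_of_hasDerivAt_neg L
    (fun t => (jointTransform φ t)ᵀ * M * jointTransform φ t)
    (fun t => (hasDerivAt_transport φ M t).congr_deriv
      (congrArg Neg.neg (transport_inertiaDeriv φ M t)))
    (quadraticEval x : SpatialMat →ₗ[ℝ] ℝ) (fun k hk => by
      simpa [jointTransform_zero, hL, quadraticEval] using h k hk) t
  simpa [jointTransform_zero, quadraticEval] using key

end

/-! ### Unidentifiable parameters and kinetic energy -/

variable {N : ℕ}

/-- At rest the generalized force is `H(q) q̈`, so an unidentifiable parameter vector has a
vanishing mass matrix; conversely a vanishing mass matrix has vanishing derivatives. -/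
theorem mem_nullspace_iff_massMatrix (S : SerialChain N) (π : Fin N → Params) :
    π ∈ S.nullspace ↔ ∀ q, S.massMatrix π q = 0 := by
  have h : π ∈ S.nullspace ↔ ∀ q qd qdd, S.torque π q qd qdd = 0 := by
    simp only [torque_eq_regressor_mulVec]
    rfl
  rw [h]
  constructor
  · intro h q
    have hc : S.coriolis π q 0 = 0 := by
      ext j
      simp [coriolis]
    refine Matrix.ext_of_mulVec_single fun j => ?_
    have := h q 0 (Pi.single j 1)
    rwa [torque, hc, add_zero, ← Matrix.zero_mulVec (Pi.single j (1 : ℝ))] at this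
  · intro h q qd qdd
    have hd (l j k) : S.massMatrixDeriv π q l j k = 0 := by
      simp [massMatrixDeriv, h]
    have hc : S.coriolis π q qd = 0 := by
      ext j
      simp [coriolis, hd]
    rw [torque, h, hc, Matrix.zero_mulVec, add_zero]

/-- The unidentifiable parameter vectors are those without kinetic energy. -/
theorem mem_nullspace_iff (S : SerialChain N) (π : Fin N → Params) :
    π ∈ S.nullspace ↔ ∀ q qd : Fin N → ℝ,
      ∑ b, S.velocity q qd b.succ ⬝ᵥ (wedge (π b) *ᵥ S.velocity q qd b.succ) = 0 := by
  have hE (q qd : Fin N → ℝ) :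
      ∑ b, S.velocity q qd b.succ ⬝ᵥ (wedge (π b) *ᵥ S.velocity q qd b.succ) =
        qd ⬝ᵥ (S.massMatrix π q *ᵥ qd) := by
    have := S.kineticEnergy_eq π q qd
    rw [kineticEnergy] at this
    linarith
  rw [mem_nullspace_iff_massMatrix]
  simp only [hE]
  constructor
  · intro h q qd
    simp [h]
  · intro h q
    have hsymm : (S.massMatrix π q)ᵀ = S.massMatrix π q := by
      ext j k
      simp only [massMatrix, Matrix.transpose_apply, Matrix.of_apply]
      exact Finset.sum_congr rfl fun b _ => dotProduct_wedge_mulVec_comm _ _ _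
    ext j k
    -- polarization
    have h1 := h q (Pi.single j 1 + Pi.single k 1)
    have h2 := h q (Pi.single j 1)
    have h3 := h q (Pi.single k 1)
    have h4 : S.massMatrix π q k j = S.massMatrix π q j k := congrFun (congrFun hsymm j) k
    simp only [Matrix.mulVec_add, dotProduct_add, add_dotProduct, Matrix.mulVec_single_one,
      single_one_dotProduct, Matrix.col_apply] at h1 h2 h3
    simp only [Matrix.zero_apply]
    linarith

/-! ### Conditions on the attainable velocities -/

theorem transpose_mulVec_eq_zero_iff {ι : Type*} [Fintype ι] {m : ℕ} (A : Matrix ι (Fin m) ℝ)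
    {s : Set (ι → ℝ)} (hA : LinearMap.range A.mulVecLin = Submodule.span ℝ s) (w : ι → ℝ) :
    Aᵀ *ᵥ w = 0 ↔ ∀ v ∈ s, v ⬝ᵥ w = 0 := by
  have hdot (u : Fin m → ℝ) : (A *ᵥ u) ⬝ᵥ w = u ⬝ᵥ (Aᵀ *ᵥ w) := by
    rw [dotProduct_comm, Matrix.dotProduct_mulVec, Matrix.mulVec_transpose, dotProduct_comm]
  constructor
  · intro h v hv
    have hv' : v ∈ LinearMap.range A.mulVecLin := hA ▸ Submodule.subset_span hv
    obtain ⟨u, rfl⟩ := hv'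
    rw [Matrix.mulVecLin_apply, hdot, h, dotProduct_zero]
  · intro h
    refine dotProduct_eq_zero _ fun u => ?_
    rw [dotProduct_comm, ← hdot]
    have hu : A *ᵥ u ∈ Submodule.span ℝ s := hA ▸ LinearMap.mem_range_self A.mulVecLin u
    generalize A *ᵥ u = x at hu ⊢
    induction hu using Submodule.span_induction with
    | mem v hv => exact h v hv
    | zero => exact zero_dotProduct _
    | add v v' _ _ hv hv' => rw [add_dotProduct, hv, hv', add_zero]
    | smul c v _ hv => rw [smul_dotProduct, hv, smul_zero]

theorem momentum_iff (S : SerialChain N) (b : Fin (N + 1)) {m : ℕ}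
    (V : Matrix SpatialIdx (Fin m) ℝ) (hV : LinearMap.range V.mulVecLin = S.velocitySpan b)
    (w : SpatialVec) : Vᵀ *ᵥ w = 0 ↔ ∀ q qd, S.velocity q qd b ⬝ᵥ w = 0 := by
  rw [transpose_mulVec_eq_zero_iff V hV]
  exact ⟨fun h q qd => h _ ⟨q, qd, rfl⟩, by rintro h _ ⟨q, qd, rfl⟩; exact h q qd⟩

theorem mulVec_eq_zero_iff_energy (S : SerialChain N) (b : Fin (N + 1)) {n : ℕ}
    (C : Matrix (Fin n) (Fin 10) ℝ) (hC : LinearMap.range (Cᵀ).mulVecLin = S.energySpan b)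
    (π : Params) : C *ᵥ π = 0 ↔
      ∀ q qd, S.velocity q qd b ⬝ᵥ (wedge π *ᵥ S.velocity q qd b) = 0 := by
  have h := transpose_mulVec_eq_zero_iff Cᵀ hC π
  rw [Matrix.transpose_transpose] at h
  rw [h]
  simp only [← energyVec_dotProduct]
  exact ⟨fun h q qd => h _ ⟨q, qd, rfl⟩, by rintro h _ ⟨q, qd, rfl⟩; exact h q qd⟩

theorem dotProduct_congr_mulVec (X M : SpatialMat) (x : SpatialVec) :
    x ⬝ᵥ ((Xᵀ * M * X) *ᵥ x) = (X *ᵥ x) ⬝ᵥ (M *ᵥ (X *ᵥ x)) := by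
  rw [← Matrix.mulVec_mulVec, ← Matrix.mulVec_mulVec, Matrix.dotProduct_mulVec x,
    Matrix.vecMul_transpose]

/-- The relaxed invariance condition, for ten orders of derivatives, is equivalent to invariance:
the energy of the transferred inertia does not depend on the position of the joint. The space of
inertial parameters has dimension ten, so the higher derivatives add nothing. -/
theorem invariance_iff (S : SerialChain N) (i : Fin N) {n : ℕ} (C : Matrix (Fin n) (Fin 10) ℝ)
    (hC : LinearMap.range (Cᵀ).mulVecLin = S.energySpan i.castSucc) (π : Params) :
    (∀ k ∈ Finset.Icc 1 10, C *ᵥ vee ((S.fixedTransform i)ᵀ *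
      (inertiaDeriv (S.freeMotion i))^[k] (wedge π) * S.fixedTransform i) = 0) ↔
    ∀ q qd t, (S.fixedTransform i *ᵥ S.velocity q qd i.castSucc) ⬝ᵥ
      (((jointTransform (S.freeMotion i) t)ᵀ * wedge π * jointTransform (S.freeMotion i) t) *ᵥ
        (S.fixedTransform i *ᵥ S.velocity q qd i.castSucc)) =
      (S.fixedTransform i *ᵥ S.velocity q qd i.castSucc) ⬝ᵥ
        (wedge π *ᵥ (S.fixedTransform i *ᵥ S.velocity q qd i.castSucc)) := by
  simp only [S.mulVec_eq_zero_iff_energy _ C hC, ← wedge_paramsDeriv_pow,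
    wedge_vee_fixedTransform, dotProduct_congr_mulVec (S.fixedTransform i)]
  constructor
  · intro h q qd
    set x := S.fixedTransform i *ᵥ S.velocity q qd i.castSucc with hx
    refine transport_const_of_iterate_inertiaDeriv_eq_zero _ _ x fun k hk => ?_
    rw [← wedge_paramsDeriv_pow]
    let f : Params →ₗ[ℝ] ℝ :=
      { toFun := fun ρ => x ⬝ᵥ (wedge ρ *ᵥ x)
        map_add' := fun ρ σ => by rw [wedge_add, Matrix.add_mulVec, dotProduct_add]
        map_smul' := fun c ρ => by rw [wedge_smul, Matrix.smul_mulVec, dotProduct_smul]; rfl }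
    refine apply_pow_eq_zero_of_le_finrank (paramsDeriv (S.freeMotion i)) f π (fun k hk => ?_) hk
    rw [Module.finrank_fin_fun] at hk
    exact h k hk q qd
  · intro h k hk q qd
    rw [wedge_paramsDeriv_pow]
    exact iterate_inertiaDeriv_eq_zero_of_transport_const _ _ _ (h q qd) (Finset.mem_Icc.1 hk).1

/-! ### Transfers across one joint -/

theorem velocity_update_of_le (S : SerialChain N) (q qd : Fin N → ℝ) (i : Fin N) (t s : ℝ)
    (b : Fin (N + 1)) (hb : b ≤ i.castSucc) :
    S.velocity (Function.update q i t) (Function.update qd i s) b = S.velocity q qd b := by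
  induction b using Fin.induction with
  | zero => rfl
  | succ j ih =>
    have hj : j ≠ i := fun h => by
      subst h
      exact absurd hb (not_le.2 Fin.castSucc_lt_succ)
    rw [velocity_succ, velocity_succ, ih (Fin.castSucc_lt_succ.le.trans hb),
      Function.update_of_ne hj, Function.update_of_ne hj]

theorem velocity_update_succ (S : SerialChain N) (q qd : Fin N → ℝ) (i : Fin N) (t s : ℝ) :
    S.velocity (Function.update q i t) (Function.update qd i s) i.succ =
      jointTransform (S.freeMotion i) t *ᵥ
        (S.fixedTransform i *ᵥ S.velocity q qd i.castSucc) + s • S.freeMotion i := by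
  rw [velocity_succ, velocity_update_of_le S q qd i t s _ le_rfl, Function.update_self,
    Function.update_self, Matrix.mulVec_mulVec]

/-- A transfer leaves the kinetic energy unchanged: by the momentum condition the motion of the
joint itself carries no energy, and by invariance the rest cancels the change of the
predecessor. -/
theorem transferSubspace_le_nullspace (S : SerialChain N) (i : Fin N) {m n : ℕ}
    (V : Matrix SpatialIdx (Fin m) ℝ)
    (hV : LinearMap.range V.mulVecLin = S.velocitySpan i.succ)
    (C : Matrix (Fin n) (Fin 10) ℝ)
    (hC : LinearMap.range (Cᵀ).mulVecLin = S.energySpan i.castSucc) :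
    S.transferSubspace i V C ≤ S.nullspace := by
  rintro δ ⟨δ₀, hδ⟩
  rw [mem_nullspace_iff]
  intro q qd
  set ε : Fin (N + 1) → Params := Fin.cons δ₀ δ with hε
  have hmom := (S.momentum_iff _ V hV _).1 hδ.momentum
  have hinv := (S.invariance_iff i C hC _).1 hδ.invariance q qd (q i)
  -- the base is at rest, so its parameter change may be added to the sum
  have hsum : ∑ b : Fin N, S.velocity q qd b.succ ⬝ᵥ (wedge (δ b) *ᵥ S.velocity q qd b.succ) =
      ∑ b : Fin (N + 1), S.velocity q qd b ⬝ᵥ (wedge (ε b) *ᵥ S.velocity q qd b) := by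
    rw [Fin.sum_univ_succ, velocity_zero, zero_dotProduct, zero_add]
    simp [hε]
  rw [hsum, Fintype.sum_eq_add i.succ i.castSucc Fin.castSucc_lt_succ.ne']
  · set x := S.fixedTransform i *ᵥ S.velocity q qd i.castSucc with hx
    set y := jointTransform (S.freeMotion i) (q i) *ᵥ x with hy
    have hv (s : ℝ) : S.velocity q (Function.update qd i s) i.succ = y + s • S.freeMotion i := by
      have := S.velocity_update_succ q qd i (q i) s
      rwa [Function.update_eq_self] at this
    have h0 : y ⬝ᵥ (wedge (ε i.succ) *ᵥ S.freeMotion i) = 0 := by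
      simpa [hv] using hmom q (Function.update qd i 0)
    have h1 := hmom q qd
    have hvi := hv (qd i)
    rw [Function.update_eq_self] at hvi
    have h2 : S.velocity q qd i.succ ⬝ᵥ (wedge (ε i.succ) *ᵥ S.velocity q qd i.succ) =
        y ⬝ᵥ (wedge (ε i.succ) *ᵥ y) := by
      conv_lhs => rw [hvi, Matrix.mulVec_add, dotProduct_add, Matrix.mulVec_smul, dotProduct_smul,
        ← hvi, h1, smul_zero, add_zero, hvi, add_dotProduct, smul_dotProduct,
        dotProduct_wedge_mulVec_comm _ (S.freeMotion i), h0, smul_zero, add_zero]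
    rw [h2, hδ.transfer, Matrix.neg_mulVec, dotProduct_neg, dotProduct_congr_mulVec, ← hx, ← hinv,
      dotProduct_congr_mulVec, ← hy, add_neg_cancel]
  · rintro b ⟨hb1, hb2⟩
    induction b using Fin.cases with
    | zero => rw [velocity_zero, zero_dotProduct]
    | succ j => rw [hδ.others j hb1 hb2, Matrix.zero_mulVec, dotProduct_zero]

/-- The change of all bodies, base included, that assigns `π` to the body after joint `i` and
compensates it on the predecessor. -/
def transferChange (S : SerialChain N) (i : Fin N) (π : Params) : Fin (N + 1) → Params :=
  Function.update (Pi.single i.succ π) i.castSucc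
    (vee (-((S.fixedTransform i)ᵀ * wedge π * S.fixedTransform i)))

theorem transferChange_succ (S : SerialChain N) (i : Fin N) (π : Params) :
    S.transferChange i π i.succ = π := by
  rw [transferChange, Function.update_of_ne Fin.castSucc_lt_succ.ne', Pi.single_eq_same]

theorem transferChange_castSucc (S : SerialChain N) (i : Fin N) (π : Params) :
    wedge (S.transferChange i π i.castSucc) =
      -((S.fixedTransform i)ᵀ * wedge π * S.fixedTransform i) := by
  have h (M : SpatialMat) (hM : wedge (vee M) = M) : wedge (vee (-M)) = -M := by
    rw [← neg_one_smul ℝ M, vee_smul, wedge_smul, hM]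
  rw [transferChange, Function.update_self, h _ (S.wedge_vee_fixedTransform i π)]

theorem transferChange_of_ne (S : SerialChain N) (i : Fin N) (π : Params) {b : Fin (N + 1)}
    (h1 : b ≠ i.succ) (h2 : b ≠ i.castSucc) : S.transferChange i π b = 0 := by
  rw [transferChange, Function.update_of_ne h2, Pi.single_eq_of_ne h1]

/-- The parameters of the last changed body of an unidentifiable change can be transferred to its
predecessor: only this body sees the motion of its joint, so its energy depends neither on the
position nor on the rate of that joint. -/
theorem transferChange_mem_transferSubspace (S : SerialChain N) (i : Fin N) {m n : ℕ}
    (V : Matrix SpatialIdx (Fin m) ℝ)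
    (hV : LinearMap.range V.mulVecLin = S.velocitySpan i.succ)
    (C : Matrix (Fin n) (Fin 10) ℝ)
    (hC : LinearMap.range (Cᵀ).mulVecLin = S.energySpan i.castSucc)
    {π : Fin N → Params} (hπ : π ∈ S.nullspace) (hlast : ∀ j, i < j → π j = 0) :
    (fun j => S.transferChange i (π i) j.succ) ∈ S.transferSubspace i V C := by
  have hcons : (Fin.cons (S.transferChange i (π i) 0) fun j => S.transferChange i (π i) j.succ :
      Fin (N + 1) → Params) = S.transferChange i (π i) := Fin.cons_self_tail _
  rw [mem_nullspace_iff] at hπ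
  have hconst (q qd : Fin N → ℝ) (t s : ℝ) :
      (jointTransform (S.freeMotion i) t *ᵥ
          (S.fixedTransform i *ᵥ S.velocity q qd i.castSucc) + s • S.freeMotion i) ⬝ᵥ
        (wedge (π i) *ᵥ (jointTransform (S.freeMotion i) t *ᵥ
          (S.fixedTransform i *ᵥ S.velocity q qd i.castSucc) + s • S.freeMotion i)) =
      -∑ b ∈ Finset.univ.erase i,
        S.velocity q qd b.succ ⬝ᵥ (wedge (π b) *ᵥ S.velocity q qd b.succ) := by
    have h := hπ (Function.update q i t) (Function.update qd i s)
    rw [← Finset.add_sum_erase _ _ (Finset.mem_univ i), velocity_update_succ] at h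
    rw [eq_neg_of_add_eq_zero_left h, neg_inj]
    refine Finset.sum_congr rfl fun b hb => ?_
    rcases lt_or_gt_of_ne (Finset.ne_of_mem_erase hb) with hbi | hbi
    · rw [velocity_update_of_le S q qd i t s b.succ (Fin.succ_le_castSucc_iff.2 hbi)]
    · simp [hlast b hbi, wedge_zero]
  refine ⟨S.transferChange i (π i) 0, ?_⟩
  rw [hcons]
  refine ⟨?_, ?_, ?_, ?_⟩
  · rw [transferChange_castSucc, transferChange_succ]
  · rw [transferChange_succ, S.momentum_iff _ V hV]
    intro q qd
    have hv := S.velocity_update_succ q qd i (q i) (qd i)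
    rw [Function.update_eq_self, Function.update_eq_self] at hv
    rw [hv]
    have h0 := hconst q qd (q i) 0
    have h1 := hconst q qd (q i) 1
    have h2 := hconst q qd (q i) (-1)
    set y := jointTransform (S.freeMotion i) (q i) *ᵥ
      (S.fixedTransform i *ᵥ S.velocity q qd i.castSucc)
    -- a quadratic polynomial in the rate that takes one value three times is constant
    simp only [Matrix.mulVec_add, Matrix.mulVec_smul, dotProduct_add, add_dotProduct,
      dotProduct_smul, smul_dotProduct, smul_eq_mul,
      dotProduct_wedge_mulVec_comm _ (S.freeMotion i) y] at h0 h1 h2 ⊢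
    have h3 : y ⬝ᵥ (wedge (π i) *ᵥ S.freeMotion i) = 0 := by linarith
    have h4 : S.freeMotion i ⬝ᵥ (wedge (π i) *ᵥ S.freeMotion i) = 0 := by linarith
    rw [h3, h4, mul_zero, add_zero]
  · rw [transferChange_succ, S.invariance_iff i C hC]
    intro q qd t
    have ht := hconst q qd t 0
    have h0 := hconst q qd 0 0
    rw [jointTransform_zero, Matrix.one_mulVec, zero_smul, add_zero] at h0
    rw [zero_smul, add_zero] at ht
    rw [dotProduct_congr_mulVec, ht, h0]
  · intro j h1 h2
    rw [transferChange_of_ne S i _ h1 h2, wedge_zero]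

/-! ### The direct sum -/

theorem apply_eq_zero_of_mem_transferSubspace {S : SerialChain N} {i : Fin N} {m n : ℕ}
    {V : Matrix SpatialIdx (Fin m) ℝ} {C : Matrix (Fin n) (Fin 10) ℝ} {δ : Fin N → Params}
    (hδ : δ ∈ S.transferSubspace i V C) {j : Fin N} (hj : i < j) : δ j = 0 := by
  obtain ⟨δ₀, h⟩ := hδ
  have h1 := h.others j (fun h => hj.ne' (Fin.succ_injective _ h))
    (Fin.castSucc_lt_succ.trans (Fin.succ_lt_succ_iff.2 hj)).ne'
  rw [Fin.cons_succ] at h1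
  rw [← vee_wedge (δ j), h1, ← wedge_zero, vee_wedge]

theorem eq_zero_of_mem_transferSubspace {S : SerialChain N} {i : Fin N} {m n : ℕ}
    {V : Matrix SpatialIdx (Fin m) ℝ} {C : Matrix (Fin n) (Fin 10) ℝ} {δ : Fin N → Params}
    (hδ : δ ∈ S.transferSubspace i V C) (hi : δ i = 0) : δ = 0 := by
  obtain ⟨δ₀, h⟩ := hδ
  have hz {π : Params} (hw : wedge π = 0) : π = 0 := by
    rw [← vee_wedge π, hw, ← wedge_zero, vee_wedge]
  ext1 j
  by_cases h1 : j.succ = i.succ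
  · rw [Fin.succ_injective _ h1, hi, Pi.zero_apply]
  by_cases h2 : j.succ = i.castSucc
  · have ht := h.transfer
    rw [← h2, Fin.cons_succ, Fin.cons_succ, hi, wedge_zero, mul_zero, zero_mul, neg_zero] at ht
    exact hz ht
  · have ho := h.others j h1 h2
    rw [Fin.cons_succ] at ho
    exact hz ho

/-- The transfer subspaces are in triangular position: in a vanishing sum of transfers, the last
nonzero one alone changes the body after its joint. -/
theorem iSupIndep_transferSubspace (S : SerialChain N) {m n : Fin (N + 1) → ℕ}
    (V : ∀ b : Fin (N + 1), Matrix SpatialIdx (Fin (m b)) ℝ)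
    (C : ∀ b : Fin (N + 1), Matrix (Fin (n b)) (Fin 10) ℝ) :
    iSupIndep fun i : Fin N => S.transferSubspace i (V i.succ) (C i.castSucc) := by
  rw [iSupIndep_iff_finsetSum_eq_zero_imp_eq_zero]
  intro s v hv hsum
  by_contra! hne
  obtain ⟨i, ⟨his, hi0⟩, hmax⟩ := Set.exists_max_image {i | i ∈ s ∧ v i ≠ 0} id
    (Set.toFinite _) hne
  refine hi0 (eq_zero_of_mem_transferSubspace (hv i his) ?_)
  have h := congrFun hsum i
  rw [Finset.sum_apply, Finset.sum_eq_single_of_mem i his] at h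
  · exact h
  · intro j hj hji
    rcases lt_or_gt_of_ne hji with hlt | hgt
    · exact apply_eq_zero_of_mem_transferSubspace (hv j hj) hlt
    · have : v j = 0 := by
        by_contra h0
        exact (hmax j ⟨hj, h0⟩).not_gt hgt
      rw [this, Pi.zero_apply]

/-- Unidentifiable changes are swept towards the base, one transfer at a time. -/
theorem nullspace_le_iSup_transferSubspace (S : SerialChain N) {m n : Fin (N + 1) → ℕ}
    (V : ∀ b : Fin (N + 1), Matrix SpatialIdx (Fin (m b)) ℝ)
    (hV : ∀ b, LinearMap.range (V b).mulVecLin = S.velocitySpan b)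
    (C : ∀ b : Fin (N + 1), Matrix (Fin (n b)) (Fin 10) ℝ)
    (hC : ∀ b, LinearMap.range ((C b)ᵀ).mulVecLin = S.energySpan b) :
    S.nullspace ≤ ⨆ i : Fin N, S.transferSubspace i (V i.succ) (C i.castSucc) := by
  suffices h : ∀ M : ℕ, M ≤ N → ∀ π ∈ S.nullspace, (∀ j : Fin N, M ≤ j.val → π j = 0) →
      π ∈ ⨆ i : Fin N, S.transferSubspace i (V i.succ) (C i.castSucc) from
    fun π hπ => h N le_rfl π hπ fun j hj => absurd j.2 (not_lt.2 hj)
  intro M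
  induction M with
  | zero =>
    intro _ π _ h0
    rw [show π = 0 from funext fun j => h0 j (Nat.zero_le _)]
    exact Submodule.zero_mem _
  | succ M ih =>
    intro hM π hπ h0
    set i : Fin N := ⟨M, hM⟩ with hi
    have hlast (j : Fin N) (hj : i < j) : π j = 0 := h0 j hj
    set δ : Fin N → Params := fun j => S.transferChange i (π i) j.succ with hδ
    have hmem := S.transferChange_mem_transferSubspace i (V i.succ) (hV _) (C i.castSucc) (hC _)
      hπ hlast
    have hrest := ih (Nat.le_of_succ_le hM) (π - δ) (S.nullspace.sub_mem hπ
      (S.transferSubspace_le_nullspace i (V i.succ) (hV _) (C i.castSucc) (hC _) hmem))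
      fun j hj => ?_
    · rw [← sub_add_cancel π δ]
      exact Submodule.add_mem _ hrest (Submodule.mem_iSup_of_mem i hmem)
    · rcases (show i ≤ j from hj).eq_or_lt with rfl | hlt
      · rw [Pi.sub_apply, sub_eq_zero]
        exact (S.transferChange_succ _ _).symm
      · rw [Pi.sub_apply, hlast j hlt, zero_sub, neg_eq_zero]
        exact apply_eq_zero_of_mem_transferSubspace hmem hlt

end SerialChain

end

theorem theorem2 {N : ℕ} (S : SerialChain N) {m n : Fin (N + 1) → ℕ}
    (V : ∀ b : Fin (N + 1), Matrix SerialChain.SpatialIdx (Fin (m b)) ℝ)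
    (hV : ∀ b, LinearMap.range (V b).mulVecLin = S.velocitySpan b)
    (C : ∀ b : Fin (N + 1), Matrix (Fin (n b)) (Fin 10) ℝ)
    (hC : ∀ b, LinearMap.range ((C b)ᵀ).mulVecLin = S.energySpan b) :
    iSupIndep (fun i : Fin N => S.transferSubspace i (V i.succ) (C i.castSucc)) ∧
      S.nullspace = ⨆ i : Fin N, S.transferSubspace i (V i.succ) (C i.castSucc) :=
  ⟨S.iSupIndep_transferSubspace V C,
    le_antisymm (S.nullspace_le_iSup_transferSubspace V hV C hC)
      (iSup_le fun i => S.transferSubspace_le_nullspace i _ (hV _) _ (hC _))⟩
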